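/- Let $A$ be a commutative noetherian ring. A full additive subcategory $\mathcal{C}$ of the category of $A$-modules is called thick if it is closed under direct summands and if, for every short exact sequence $0\to X\to Y\to Z\to 0$ of $A$-modules with two terms in $\mathcal{C}$, the third term also belongs to $\mathcal{C}$. The singular locus of $A$ is the set of all prime ideals $\mathfrak{p}$ of $A$ such that the local ring $A_{\mathfrak{p}}$ is not regular. Then the smallest thick subcategory of the category of $A$-modules containing $A$ and $A/\mathfrak{p}$ for all $\mathfrak{p}$ in the singular locus of $A$ equals the category of noetherian (equivalently, finitely generated) $A$-modules. -/

import Mathlib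

open CategoryTheory CategoryTheory.Limits

universe u v

/-- A full subcategory of an abelian category (given by the property `P` of its objects) is
*thick* if it is additive (it contains a zero object and the sum of any two of its objects), it is
closed under direct summands, and whenever two terms of a short exact sequence
`0 ⟶ X₁ ⟶ X₂ ⟶ X₃ ⟶ 0` belong to it, so does the third. In an abelian category the direct summands
of an object are precisely its retracts; in particular `P` is closed under isomorphisms. -/
structure IsThickSubcategory {C : Type u} [Category.{v} C] [Abelian C]
    (P : ObjectProperty C) : Prop where
  containsZero : P.ContainsZero
  biprod : ∀ X Y : C, P X → P Y → P (X ⊞ Y)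
  isStableUnderRetracts : P.IsStableUnderRetracts
  left : ∀ S : ShortComplex C, S.ShortExact → P S.X₂ → P S.X₃ → P S.X₁
  middle : ∀ S : ShortComplex C, S.ShortExact → P S.X₁ → P S.X₃ → P S.X₂
  right : ∀ S : ShortComplex C, S.ShortExact → P S.X₁ → P S.X₂ → P S.X₃

/-- The smallest thick subcategory containing the objects satisfying `Q`: the intersection of all
thick subcategories containing them. -/
def thickClosure {C : Type u} [Category.{v} C] [Abelian C]
    (Q : ObjectProperty C) : ObjectProperty C :=
  fun X => ∀ P : ObjectProperty C, IsThickSubcategory P → Q ≤ P → P X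

/-- `thickClosure Q` is indeed the least thick subcategory containing `Q`. -/
theorem isLeast_thickClosure {C : Type u} [Category.{v} C] [Abelian C] (Q : ObjectProperty C) :
    IsLeast {P : ObjectProperty C | IsThickSubcategory P ∧ Q ≤ P} (thickClosure Q) := by
  refine ⟨⟨⟨⟨(HasZeroObject.zero (C := C)).choose,
    HasZeroObject.zero.choose_spec, fun P hP _ => ?_⟩, fun X Y hX hY P hP h =>
    hP.biprod X Y (hX P hP h) (hY P hP h), ⟨fun {X Y} r hY P hP h => ?_⟩,
    fun S hS h₁ h₂ P hP h => hP.left S hS (h₁ P hP h) (h₂ P hP h),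
    fun S hS h₁ h₂ P hP h => hP.middle S hS (h₁ P hP h) (h₂ P hP h),
    fun S hS h₁ h₂ P hP h => hP.right S hS (h₁ P hP h) (h₂ P hP h)⟩,
    fun X hX P _ h => h X hX⟩, fun P hP X hX => hX P hP.1 hP.2⟩
  · have := hP.isStableUnderRetracts
    obtain ⟨Z, hZ, hPZ⟩ := hP.containsZero.exists_zero
    exact P.prop_of_iso (hZ.iso HasZeroObject.zero.choose_spec) hPZ
  · have := hP.isStableUnderRetracts
    exact P.prop_of_retract r (hY P hP h)

/-- The singular locus of `A`: the primes `p` such that the local ring `A_p` is not regular. -/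
def singularLocus (A : Type u) [CommRing A] : Set (PrimeSpectrum A) :=
  {p | ¬ IsRegularLocalRing (Localization.AtPrime p.asIdeal)}

/-- The `A`-modules `A` and `A/p`, where `p` runs through the singular locus of `A`. -/
def schoutensGenerators (A : Type u) [CommRing A] : ObjectProperty (ModuleCat.{u} A) :=
  fun M => M = ModuleCat.of A A ∨ ∃ p ∈ singularLocus A, M = ModuleCat.of A (A ⧸ p.asIdeal)

/-- The full subcategory of noetherian `A`-modules. -/
def noetherianModules (A : Type u) [CommRing A] : ObjectProperty (ModuleCat.{u} A) :=
  fun M => IsNoetherian A M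

/-! Noetherian modules form a thick subcategory containing the generators. Conversely, by dévissage
it suffices to put every `A ⧸ p` in a thick `P` containing the generators, by noetherian induction
on `p`; only `p` with `A_p` regular needs an argument.

The residue field of `A_p` then has finite projective dimension `n`. Clearing denominators gives `s
∉ p` such that multiplication by `s` on an `n`-th syzygy of `A ⧸ p` factors through a finite free
module (`exists_sMulFactorsOnSyzygy`).

For a surjection `π : F → M` with `F` free, let `E` be the pullback of `π` along `s : M → M`. For `M
= A ⧸ p`, `E` embeds in `F` with cokernel `M/sM`, which is in `P` because only primes strictly above
`p` contain its annihilator. Membership of `E` in `P` passes from `M` to its syzygies. On the `n`-th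
syzygy the factorization makes the module a retract of `E`, so that syzygy is in `P`, and climbing
back up the resolution puts `A ⧸ p` in `P` (`IsThickSubcategory.of_sMulFactorsOnSyzygy`). -/

/-! ### Regular local rings: domains with a regular sequence generating the maximal ideal. -/

open IsLocalRing in
/-- Replacing one element of a minimal generating set of the maximal ideal by `x ∉ 𝔪²`. -/
theorem IsLocalRing.exists_span_insert_eq_maximalIdeal {R : Type u} [CommRing R] [IsLocalRing R]
    [IsNoetherianRing R] {n : ℕ} (hn : (maximalIdeal R).spanFinrank ≤ n + 1) {x : R}
    (hx : x ∈ maximalIdeal R) (hx2 : x ∉ maximalIdeal R * maximalIdeal R) :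
    ∃ s : Finset R, s.card ≤ n ∧ Ideal.span (insert x (s : Set R)) = maximalIdeal R := by
  classical
  have hfg : Submodule.FG (maximalIdeal R) := IsNoetherian.noetherian _
  have hfin := hfg.finite_generators
  obtain ⟨t, ht⟩ := hfin.exists_finset_coe
  have hcard : t.card ≤ n + 1 := by
    rw [← Set.ncard_coe_finset, ht, hfg.generators_ncard]; exact hn
  have hspan : Ideal.span (t : Set R) = maximalIdeal R := by
    rw [ht]; exact Submodule.span_generators _
  have hxs : x ∈ Submodule.span R (t : Set R) := by
    change x ∈ Ideal.span (t : Set R)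
    rwa [hspan]
  obtain ⟨f, -, hf⟩ := Submodule.mem_span_finset.mp hxs
  have htm : ∀ a ∈ t, a ∈ maximalIdeal R := fun a ha => hspan ▸ Ideal.subset_span ha
  -- If all coefficients of `x` lay in `𝔪`, then `x` would lie in `𝔪²`. A generator with unit
  -- coefficient can be traded for `x`.
  obtain ⟨a, ha, hfa⟩ : ∃ a ∈ t, f a ∉ maximalIdeal R := by
    by_contra! h
    exact hx2 (hf ▸ Ideal.sum_mem _ fun a ha => Ideal.mul_mem_mul (h a ha) (htm a ha))
  refine ⟨t.erase a, by rw [Finset.card_erase_of_mem ha]; omega, le_antisymm ?_ ?_⟩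
  · rw [Ideal.span_le]
    rintro y (rfl | hy)
    · exact hx
    · exact htm y (Finset.mem_of_mem_erase hy)
  · rw [← hspan, Ideal.span_le]
    intro y hy
    by_cases hya : y = a
    · subst hya
      have hu : IsUnit (f y) := by simpa using hfa
      rw [SetLike.mem_coe, ← Ideal.unit_mul_mem_iff_mem _ hu]
      have : f y * y = x - ∑ b ∈ t.erase y, f b * b := by
        rw [← hf, ← Finset.add_sum_erase _ _ ha]; simp
      rw [this]
      refine Ideal.sub_mem _ (Ideal.subset_span (Set.mem_insert _ _)) (Ideal.sum_mem _ fun b hb => ?_)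
      exact Ideal.mul_mem_left _ _ (Ideal.subset_span (Set.mem_insert_of_mem _ hb))
    · exact Ideal.subset_span (Set.mem_insert_of_mem _ (Finset.mem_erase.mpr ⟨hya, hy⟩))

open IsLocalRing in
/-- In a noetherian local ring of positive dimension there is an element of `𝔪` that lies neither
in `𝔪²` nor in any minimal prime. -/
theorem IsLocalRing.exists_mem_maximalIdeal_notMem_sq_notMem_minimalPrimes {R : Type u} [CommRing R]
    [IsLocalRing R] [IsNoetherianRing R] (hd : 0 < ringKrullDim R) :
    ∃ x ∈ maximalIdeal R, x ∉ maximalIdeal R * maximalIdeal R ∧ ∀ q ∈ minimalPrimes R, x ∉ q := by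
  by_contra! h
  have hfin : (insert (maximalIdeal R * maximalIdeal R) (minimalPrimes R)).Finite :=
    (minimalPrimes.finite_of_isNoetherianRing R).insert _
  have hnot : maximalIdeal R ∉ minimalPrimes R := fun hm => by
    rw [← maximalIdeal_height_eq_ringKrullDim, (Ideal.height_eq_zero_iff).mpr hm] at hd
    simp at hd
  have hsub : (maximalIdeal R : Set R) ⊆
      ⋃ i ∈ insert (maximalIdeal R * maximalIdeal R) (minimalPrimes R), (id i : Ideal R) := by
    intro x hx
    by_cases hx2 : x ∈ maximalIdeal R * maximalIdeal R
    · exact Set.mem_biUnion (Set.mem_insert _ _) hx2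
    · obtain ⟨q, hq, hxq⟩ := h x hx hx2
      exact Set.mem_biUnion (Set.mem_insert_of_mem _ hq) hxq
  -- Prime avoidance tolerates two non-prime ideals; `𝔪²` fills both places.
  obtain ⟨I, hI, hle⟩ := (Ideal.subset_union_prime_finite hfin (maximalIdeal R * maximalIdeal R)
    (maximalIdeal R * maximalIdeal R) (fun i hi hne _ => by
      rcases hi with rfl | hi
      · exact absurd rfl hne
      · exact hi.1.1)).mp hsub
  rcases hI with rfl | hI
  -- Nakayama: `𝔪 ⊆ 𝔪²` forces `𝔪 = 0`, which would be a minimal prime.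
  · have hbot : maximalIdeal R = ⊥ := Submodule.eq_bot_of_le_smul_of_le_jacobson_bot _ _
      (IsNoetherian.noetherian _) hle (maximalIdeal_le_jacobson _)
    refine hnot ⟨⟨inferInstance, bot_le⟩, fun J _ _ => ?_⟩
    rw [hbot]; exact bot_le
  · have hq : I.IsPrime := hI.1.1
    exact hnot ((le_antisymm hle (le_maximalIdeal hq.ne_top)) ▸ hI)

open IsLocalRing RingTheory.Sequence in
/-- A regular local ring is a domain, and its maximal ideal is generated by a regular sequence. -/
theorem IsRegularLocalRing.isDomain_and_exists_isWeaklyRegular (R : Type u) [CommRing R]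
    [IsRegularLocalRing R] :
    IsDomain R ∧ ∃ rs : List R, IsWeaklyRegular R rs ∧ Ideal.ofList rs = maximalIdeal R := by
  obtain ⟨n, hn⟩ : ∃ n, (maximalIdeal R).spanFinrank ≤ n := ⟨_, le_rfl⟩
  induction n generalizing R with
  | zero =>
    have hbot : maximalIdeal R = ⊥ :=
      (Submodule.spanFinrank_eq_zero_iff_eq_bot (IsNoetherian.noetherian _)).mp (by omega)
    exact ⟨(isField_iff_maximalIdeal_eq.mpr hbot).isDomain, [], IsWeaklyRegular.nil _ _,
      by rw [hbot, Ideal.ofList_nil]⟩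
  | succ n ih =>
    rcases Nat.lt_or_ge n (maximalIdeal R).spanFinrank with hlt | hle
    swap
    · exact ih R hle
    have hdim : ringKrullDim R = (n + 1 : ℕ) := by
      rw [← IsRegularLocalRing.spanFinrank_maximalIdeal, le_antisymm hn hlt]
    obtain ⟨x, hx, hx2, hmin⟩ :=
      exists_mem_maximalIdeal_notMem_sq_notMem_minimalPrimes (R := R) (by
        rw [hdim]; exact_mod_cast Nat.succ_pos n)
    obtain ⟨s, hs, hspan⟩ := exists_span_insert_eq_maximalIdeal hn hx hx2
    let Q := R ⧸ Ideal.span {x}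
    have hle : Ideal.span {x} ≤ maximalIdeal R := by simpa [Ideal.span_le] using hx
    have : Nontrivial Q := Ideal.Quotient.nontrivial_iff.mpr
      (ne_top_of_le_ne_top (maximalIdeal.isMaximal R).ne_top hle)
    have hsurj : Function.Surjective (Ideal.Quotient.mk (Ideal.span {x})) :=
      Ideal.Quotient.mk_surjective
    have : IsLocalRing Q := .of_surjective' _ hsurj
    have hmap : (maximalIdeal R).map (Ideal.Quotient.mk (Ideal.span {x})) = maximalIdeal Q := by
      have := Ideal.comap_isMaximal_of_surjective _ hsurj (K := maximalIdeal Q)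
      rw [← eq_maximalIdeal this, Ideal.map_comap_of_surjective _ hsurj]
    have hrank : (maximalIdeal Q).spanFinrank ≤ n := by
      have : maximalIdeal Q = Ideal.span (Ideal.Quotient.mk (Ideal.span {x}) '' (s : Set R)) := by
        rw [← hmap, ← hspan, Ideal.map_span, Set.image_insert_eq,
          Ideal.Quotient.eq_zero_iff_mem.mpr (Ideal.mem_span_singleton_self x),
          Ideal.span_insert_zero]
      rw [this]
      refine (Submodule.spanFinrank_span_le_ncard_of_finite (s.finite_toSet.image _)).trans ?_
      refine (Set.ncard_image_le s.finite_toSet).trans ?_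
      rwa [Set.ncard_coe_finset]
    -- Killing one element lowers the dimension by at most one, while the number of generators has
    -- dropped to `n`; hence `Q` is regular.
    have hdimQ : (n : WithBot ℕ∞) ≤ ringKrullDim Q := by
      have h := ringKrullDim_le_ringKrullDim_quotient_add_encard {x}
        (by simpa [IsLocalRing.ringJacobson_eq_maximalIdeal] using hx)
      rw [hdim, Set.encard_singleton] at h
      push_cast at h
      exact ENat.WithBot.add_le_add_one_right_iff.mp h
    have : IsRegularLocalRing Q := .of_spanFinrank_maximalIdeal_le _
      (le_trans (by exact_mod_cast hrank) hdimQ)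
    obtain ⟨hdom, rs, hreg, hrs⟩ := ih Q hrank
    have hprime : (Ideal.span {x}).IsPrime := Ideal.Quotient.isDomain_iff_prime _ |>.mp hdom
    have hdomR : IsDomain R := by
      obtain ⟨q, hq, hqx⟩ := Ideal.exists_minimalPrimes_le (bot_le (a := Ideal.span {x}))
      have hqp : q.IsPrime := hq.1.1
      -- A minimal prime `q ⊆ (x)` omits `x`, so each `x * z` in `q` has `z ∈ q`. Thus `q ⊆ 𝔪q`, and
      -- Nakayama gives `q = 0`.
      have hbot : q = ⊥ := by
        refine Submodule.eq_bot_of_le_smul_of_le_jacobson_bot (maximalIdeal R) _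
          (IsNoetherian.noetherian _) (fun y hy => ?_) (maximalIdeal_le_jacobson _)
        obtain ⟨z, rfl⟩ := Ideal.mem_span_singleton.mp (hqx hy)
        exact Ideal.mul_mem_mul hx ((hqp.mem_or_mem hy).resolve_left (hmin q hq))
      rw [hbot] at hqp
      exact IsDomain.of_bot_isPrime R
    have hx0 : x ≠ 0 := fun h => hx2 (h ▸ zero_mem _)
    obtain ⟨rs, rfl⟩ := List.map_surjective_iff.mpr hsurj rs
    refine ⟨hdomR, x :: rs, (isWeaklyRegular_cons_iff _ _ _).mpr ⟨?_, ?_⟩, ?_⟩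
    · exact fun a b h => mul_left_cancel₀ hx0 h
    · have e : QuotSMulTop x R ≃ₗ[R] Q := Submodule.quotEquivOfEq _ _ (by
        rw [← Submodule.ideal_span_singleton_smul, smul_eq_mul, Ideal.mul_top])
      rw [e.isWeaklyRegular_congr]
      exact (isWeaklyRegular_map_algebraMap_iff Q Q rs).mp hreg
    · rw [← Ideal.map_ofList, ← hmap] at hrs
      have := congrArg (Ideal.comap (Ideal.Quotient.mk (Ideal.span {x}))) hrs
      rw [Ideal.comap_map_of_surjective _ hsurj, Ideal.comap_map_of_surjective _ hsurj,
        ← RingHom.ker_eq_comap_bot, Ideal.mk_ker, sup_eq_left.mpr hle] at this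
      rw [Ideal.ofList_cons, sup_comm, this]

/-! ### Thick subcategories in terms of linear maps. -/

namespace IsThickSubcategory

variable {A : Type u} [CommRing A] {P : ObjectProperty (ModuleCat.{u} A)}

section

variable {X Y Z : Type u} [AddCommGroup X] [Module A X] [AddCommGroup Y] [Module A Y]
  [AddCommGroup Z] [Module A Z]

theorem of_retract_linearMap (hP : IsThickSubcategory P) (i : X →ₗ[A] Y) (r : Y →ₗ[A] X)
    (h : r ∘ₗ i = LinearMap.id) (hY : P (ModuleCat.of A Y)) : P (ModuleCat.of A X) := by
  have := hP.isStableUnderRetracts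
  exact P.prop_of_retract (X := ModuleCat.of A X) (Y := ModuleCat.of A Y)
    ⟨ModuleCat.ofHom i, ModuleCat.ofHom r, by rw [← ModuleCat.ofHom_comp, h]; rfl⟩ hY

theorem of_linearEquiv (hP : IsThickSubcategory P) (e : X ≃ₗ[A] Y)
    (hX : P (ModuleCat.of A X)) : P (ModuleCat.of A Y) :=
  hP.of_retract_linearMap e.symm.toLinearMap e.toLinearMap (by ext; simp) hX

theorem of_subsingleton (hP : IsThickSubcategory P) [Subsingleton X] : P (ModuleCat.of A X) := by
  have := hP.isStableUnderRetracts
  obtain ⟨Z, hZ, hPZ⟩ := hP.containsZero.exists_zero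
  exact P.prop_of_iso (hZ.iso (ModuleCat.isZero_of_subsingleton (ModuleCat.of A X))) hPZ

theorem shortExact_of_exact {f : X →ₗ[A] Y} {g : Y →ₗ[A] Z} (hf : Function.Injective f)
    (hg : Function.Surjective g) (h : Function.Exact f g) :
    (ShortComplex.mk (ModuleCat.ofHom f) (ModuleCat.ofHom g)
      (by rw [← ModuleCat.ofHom_comp, h.linearMap_comp_eq_zero]; rfl)).ShortExact where
  exact := (ShortComplex.ShortExact.moduleCat_exact_iff_function_exact _).mpr h
  mono_f := (ModuleCat.mono_iff_injective _).mpr hf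
  epi_g := (ModuleCat.epi_iff_surjective _).mpr hg

theorem left_of_exact (hP : IsThickSubcategory P) {f : X →ₗ[A] Y} {g : Y →ₗ[A] Z}
    (hf : Function.Injective f) (hg : Function.Surjective g) (h : Function.Exact f g)
    (hY : P (ModuleCat.of A Y)) (hZ : P (ModuleCat.of A Z)) : P (ModuleCat.of A X) :=
  hP.left _ (shortExact_of_exact hf hg h) hY hZ

theorem middle_of_exact (hP : IsThickSubcategory P) {f : X →ₗ[A] Y} {g : Y →ₗ[A] Z}
    (hf : Function.Injective f) (hg : Function.Surjective g) (h : Function.Exact f g)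
    (hX : P (ModuleCat.of A X)) (hZ : P (ModuleCat.of A Z)) : P (ModuleCat.of A Y) :=
  hP.middle _ (shortExact_of_exact hf hg h) hX hZ

theorem right_of_exact (hP : IsThickSubcategory P) {f : X →ₗ[A] Y} {g : Y →ₗ[A] Z}
    (hf : Function.Injective f) (hg : Function.Surjective g) (h : Function.Exact f g)
    (hX : P (ModuleCat.of A X)) (hY : P (ModuleCat.of A Y)) : P (ModuleCat.of A Z) :=
  hP.right _ (shortExact_of_exact hf hg h) hX hY

theorem of_ker_of_surjective (hP : IsThickSubcategory P) {g : Y →ₗ[A] Z}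
    (hg : Function.Surjective g) (hK : P (ModuleCat.of A (LinearMap.ker g)))
    (hY : P (ModuleCat.of A Y)) : P (ModuleCat.of A Z) :=
  hP.right_of_exact (LinearMap.ker g).injective_subtype hg g.exact_subtype_ker_map hK hY

theorem prod (hP : IsThickSubcategory P) (hX : P (ModuleCat.of A X))
    (hY : P (ModuleCat.of A Y)) : P (ModuleCat.of A (X × Y)) :=
  hP.middle_of_exact (LinearMap.inl_injective (R := A) (M := X) (M₂ := Y))
    (LinearMap.snd_surjective (R := A) (M := X) (M₂ := Y)) (Function.Exact.inl_snd) hX hY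

theorem pi_fin (hP : IsThickSubcategory P) (hX : P (ModuleCat.of A X)) (n : ℕ) :
    P (ModuleCat.of A (Fin n → X)) := by
  induction n with
  | zero => exact hP.of_subsingleton
  | succ n ih => exact hP.of_linearEquiv (Fin.consLinearEquiv A fun _ => X) (hP.prod hX ih)

end

end IsThickSubcategory

/-! ### The pullback of a cover along multiplication by `s`. -/

section SMulPullback

variable {A : Type u} [CommRing A] {M F : Type u} [AddCommGroup M] [Module A M]
  [AddCommGroup F] [Module A F]

/-- The pullback of `π : F → M` along the multiplication by `s` on `M`. -/
def smulPullback (s : A) (π : F →ₗ[A] M) : Submodule A (M × F) :=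
  LinearMap.eqLocus (s • LinearMap.fst A M F) (π ∘ₗ LinearMap.snd A M F)

theorem mem_smulPullback {s : A} {π : F →ₗ[A] M} {x : M × F} :
    x ∈ smulPullback s π ↔ s • x.1 = π x.2 := Iff.rfl

variable {P : ObjectProperty (ModuleCat.{u} A)}

-- When `s` is regular on `M`, the projection of the pullback to `F` is injective with image
-- `π⁻¹(sM)`, so its cokernel is `M/sM`.
open scoped Pointwise in
theorem IsThickSubcategory.smulPullback_of_quotSMulTop (hP : IsThickSubcategory P) {s : A}
    {π : F →ₗ[A] M} (hπ : Function.Surjective π) (hs : IsSMulRegular M s)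
    (hF : P (ModuleCat.of A F)) (hM : P (ModuleCat.of A (QuotSMulTop s M))) :
    P (ModuleCat.of A (smulPullback s π)) := by
  refine hP.left_of_exact (f := LinearMap.snd A M F ∘ₗ (smulPullback s π).subtype)
    (g := (s • (⊤ : Submodule A M)).mkQ ∘ₗ π) ?_ ((Submodule.mkQ_surjective _).comp hπ) ?_ hF hM
  · rintro ⟨⟨m, f⟩, h⟩ ⟨⟨m', f'⟩, h'⟩ hff
    obtain rfl : f = f' := hff
    obtain rfl : m = m' := hs (h.trans h'.symm)
    rfl
  · intro f
    simp only [LinearMap.comp_apply, Submodule.mkQ_apply, Submodule.Quotient.mk_eq_zero,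
      Submodule.mem_smul_pointwise_iff_exists, Submodule.mem_top, true_and]
    constructor
    · rintro ⟨m, hm⟩
      exact ⟨⟨(m, f), hm⟩, rfl⟩
    · rintro ⟨⟨⟨m, f'⟩, h⟩, rfl⟩
      exact ⟨m, h⟩

variable {F' : Type u} [AddCommGroup F'] [Module A F']

/-- With `E`, `E'` the pullbacks for `π`, `π'`, there is a short exact sequence `0 → E' → F × F' → E
→ 0` whose second map is `(f, f') ↦ (π f, s f - π' f')`. -/
theorem IsThickSubcategory.smulPullback_ker (hP : IsThickSubcategory P) {s : A}
    {π : F →ₗ[A] M} (hπ : Function.Surjective π) {π' : F' →ₗ[A] LinearMap.ker π}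
    (hπ' : Function.Surjective π') (hF : P (ModuleCat.of A F)) (hF' : P (ModuleCat.of A F'))
    (hM : P (ModuleCat.of A (smulPullback s π))) :
    P (ModuleCat.of A (smulPullback s π')) := by
  let g : F × F' →ₗ[A] smulPullback s π :=
    LinearMap.codRestrict _ ((π ∘ₗ LinearMap.fst A F F').prod
      (s • LinearMap.fst A F F' - (LinearMap.ker π).subtype ∘ₗ π' ∘ₗ LinearMap.snd A F F'))
      fun x => by simp [mem_smulPullback]
  refine hP.left_of_exact (f := ((LinearMap.ker π).subtype.prodMap LinearMap.id) ∘ₗ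
    (smulPullback s π').subtype) (g := g) ?_ ?_ ?_ (hP.prod hF hF') hM
  · exact (Function.Injective.prodMap (LinearMap.ker π).injective_subtype
      Function.injective_id).comp (Submodule.injective_subtype _)
  · rintro ⟨⟨m, f⟩, h⟩
    obtain ⟨f₀, rfl⟩ := hπ m
    obtain ⟨f', hf'⟩ := hπ' ⟨s • f₀ - f, by
      simpa [sub_eq_zero] using (mem_smulPullback.mp h)⟩
    refine ⟨(f₀, f'), Subtype.ext (Prod.ext rfl ?_)⟩
    simp [g, hf']
  · rintro ⟨f, f'⟩
    simp only [g, Subtype.ext_iff, LinearMap.codRestrict_apply, LinearMap.prod_apply,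
      Prod.ext_iff, ZeroMemClass.coe_zero, Prod.fst_zero, Prod.snd_zero]
    constructor
    · rintro ⟨h1, h2⟩
      exact ⟨⟨(⟨f, h1⟩, f'), Subtype.ext (sub_eq_zero.mp h2)⟩, rfl⟩
    · rintro ⟨⟨⟨⟨m, hm⟩, f''⟩, h⟩, hx⟩
      obtain ⟨rfl, rfl⟩ := Prod.ext_iff.mp hx
      exact ⟨hm, sub_eq_zero.mpr (congrArg Subtype.val h)⟩

/-- The map `m ↦ (m, f m)` is a section of the projection from the pullback to `M`. -/
theorem IsThickSubcategory.of_smulPullback_of_comp_eq (hP : IsThickSubcategory P) {s : A}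
    {π : F →ₗ[A] M} {f : M →ₗ[A] F} (hf : π ∘ₗ f = s • LinearMap.id)
    (hE : P (ModuleCat.of A (smulPullback s π))) : P (ModuleCat.of A M) :=
  hP.of_retract_linearMap
    (LinearMap.codRestrict (smulPullback s π) (LinearMap.id.prod f) fun m =>
      (LinearMap.congr_fun hf m).symm)
    (LinearMap.fst A M F ∘ₗ (smulPullback s π).subtype) rfl hE

end SMulPullback

/-! ### Syzygies and clearing of denominators. -/

/-- Multiplication by `s` on some `n`-th syzygy of `M` by finite free modules factors through a
finite free module. -/
def SMulFactorsOnSyzygy {A : Type u} [CommRing A] (s : A) : ℕ → ModuleCat.{u} A → Prop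
  | 0, M => ∃ (k : ℕ) (π : (Fin k → A) →ₗ[A] M) (f : M →ₗ[A] (Fin k → A)), π ∘ₗ f = s • LinearMap.id
  | n + 1, M => ∃ (k : ℕ) (π : (Fin k → A) →ₗ[A] M), Function.Surjective π ∧
      SMulFactorsOnSyzygy s n (ModuleCat.of A (LinearMap.ker π))

/-- Induction down the syzygies transports the pullback condition `hE`; each kernel found in `P`
then puts its cokernel in `P`. The condition covers all surjections because the one used at the last
stage is not known in advance. -/
theorem IsThickSubcategory.of_sMulFactorsOnSyzygy {A : Type u} [CommRing A] [IsNoetherianRing A]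
    {P : ObjectProperty (ModuleCat.{u} A)} (hP : IsThickSubcategory P)
    (hA : P (ModuleCat.of A A)) {s : A} {n : ℕ} {M : ModuleCat.{u} A} [Module.Finite A M]
    (h : SMulFactorsOnSyzygy s n M)
    (hE : ∀ (k : ℕ) (π : (Fin k → A) →ₗ[A] M), Function.Surjective π →
      P (ModuleCat.of A (smulPullback s π))) : P M := by
  induction n generalizing M with
  | zero =>
    obtain ⟨k, g, f, hgf⟩ := h
    -- The map `g` of the factorization need not be surjective, so it is lifted through a surjection
    -- `π`, to which `hE` applies.
    obtain ⟨m, π, hπ⟩ := Module.Finite.exists_fin' A M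
    obtain ⟨g', hg'⟩ := Module.projective_lifting_property π g hπ
    refine hP.of_smulPullback_of_comp_eq (π := π) (f := g' ∘ₗ f) ?_ (hE m π hπ)
    rw [← LinearMap.comp_assoc, hg', hgf]
  | succ n ih =>
    obtain ⟨k, π, hπ, h⟩ := h
    exact hP.of_ker_of_surjective hπ (ih h fun m π' hπ' =>
      hP.smulPullback_ker hπ hπ' (hP.pi_fin hA k) (hP.pi_fin hA m) (hE k π hπ)) (hP.pi_fin hA k)

/-- If a localization of a finite module is projective, multiplication by some denominator
factors through a finite free module. -/
theorem exists_sMulFactorsOnSyzygy_zero {A : Type u} [CommRing A] [IsNoetherianRing A]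
    (S : Submonoid A) (M : ModuleCat.{u} A) [Module.Finite A M]
    [Module.Projective (Localization S) (M.localizedModule S)] :
    ∃ s ∈ S, SMulFactorsOnSyzygy s 0 M := by
  obtain ⟨k, π, hπ⟩ := Module.Finite.exists_fin' A M
  have : Module.FinitePresentation A M := Module.finitePresentation_of_finite A M
  let mkF : (Fin k → A) →ₗ[A] LocalizedModule S (Fin k → A) := LocalizedModule.mkLinearMap S _
  let mkM : M →ₗ[A] M.localizedModule S := M.localizedModuleMkLinearMap S
  let πS := IsLocalizedModule.mapExtendScalars S mkF mkM (Localization S) π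
  have hπS : Function.Surjective πS := IsLocalizedModule.map_surjective S mkF mkM π hπ
  obtain ⟨σ, hσ⟩ := Module.projective_lifting_property πS LinearMap.id hπS
  -- The section `σ` of the localized cover descends to `f` after multiplication by a denominator
  -- `s`. Then `π ∘ f` and `s` agree only after localization; a further factor `t` makes them agree
  -- on `M`.
  obtain ⟨f, s, hf⟩ := Module.FinitePresentation.exists_lift_of_isLocalizedModule S mkF
    (σ.restrictScalars A ∘ₗ mkM)
  have hcomp : mkM ∘ₗ (π ∘ₗ f) = mkM ∘ₗ ((s : A) • LinearMap.id) := by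
    ext m
    have h1 : πS (mkF (f m)) = mkM (π (f m)) := IsLocalizedModule.map_apply S mkF mkM π (f m)
    have h2 : mkF (f m) = (s : A) • σ (mkM m) := LinearMap.congr_fun hf m
    have h3 : πS (σ (mkM m)) = mkM m := LinearMap.congr_fun hσ (mkM m)
    simp only [LinearMap.comp_apply, LinearMap.smul_apply, LinearMap.id_apply, map_smul]
    rw [← h1, h2, LinearMap.map_smul_of_tower, h3]
  obtain ⟨t, ht⟩ := Module.Finite.exists_smul_of_comp_eq_of_isLocalizedModule S mkM _ _ hcomp
  refine ⟨t * s, mul_mem t.2 s.2, k, π, (t : A) • f, ?_⟩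
  rw [LinearMap.comp_smul, mul_smul]
  exact ht

theorem exists_sMulFactorsOnSyzygy {A : Type u} [CommRing A] [IsNoetherianRing A]
    (S : Submonoid A) (n : ℕ) (M : ModuleCat.{u} A) [Module.Finite A M]
    [HasProjectiveDimensionLE (M.localizedModule S) n] :
    ∃ s ∈ S, SMulFactorsOnSyzygy s n M := by
  induction n generalizing M with
  | zero =>
    have h : HasProjectiveDimensionLE (M.localizedModule S) 0 := ‹_›
    rw [← projective_iff_hasProjectiveDimensionLE_zero, ← IsProjective.iff_projective] at h
    exact exists_sMulFactorsOnSyzygy_zero S M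
  | succ n ih =>
    obtain ⟨k, π, hπ⟩ := Module.Finite.exists_fin' A M
    have hT := (LinearMap.shortExact_shortComplexKer hπ).map_of_exact
      (ModuleCat.localizedModuleFunctor S)
    have : Projective (ModuleCat.of A (Fin k → A)) := by
      rw [← IsProjective.iff_projective]; infer_instance
    have hproj : Projective (π.shortComplexKer.map (ModuleCat.localizedModuleFunctor S)).X₂ :=
      (ModuleCat.localizedModuleFunctor.{u} S).projective_obj (ModuleCat.of A (Fin k → A))
    -- Localization is exact and preserves this projective, so passing to the kernel lowers the
    -- projective dimension bound by one.
    have : HasProjectiveDimensionLE ((ModuleCat.of A (LinearMap.ker π)).localizedModule S) n :=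
      (hT.hasProjectiveDimensionLT_X₃_iff n hproj).mp
        ‹HasProjectiveDimensionLE (M.localizedModule S) (n + 1)›
    obtain ⟨s, hs, h⟩ := ih (ModuleCat.of A (LinearMap.ker π))
    exact ⟨s, hs, k, π, hπ, h⟩

/-! ### Finite projective dimension at regular primes. -/

/-- The residue field of a regular local ring has finite projective dimension. -/
theorem IsRegularLocalRing.exists_hasProjectiveDimensionLE (R : Type u) [CommRing R]
    [IsRegularLocalRing R] :
    ∃ n : ℕ, HasProjectiveDimensionLE (ModuleCat.of R (R ⧸ IsLocalRing.maximalIdeal R)) n := by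
  obtain ⟨-, rs, hreg, hrs⟩ := IsRegularLocalRing.isDomain_and_exists_isWeaklyRegular R
  have h := ModuleCat.projectiveDimension_quotient_eq_add_length_of_isWeaklyRegular
    (ModuleCat.of R R) rs hreg (fun r hr => hrs ▸ Ideal.subset_span hr)
  rw [ModuleCat.projectiveDimension_eq_zero_of_projective (ModuleCat.of R R), zero_add] at h
  refine ⟨rs.length, ?_⟩
  have h' := (projectiveDimension_le_iff _ _).mp h.le
  exact hasProjectiveDimensionLT_of_iso (LinearEquiv.toModuleIso (Submodule.quotEquivOfEq
    (Ideal.ofList rs • (⊤ : Submodule R R)) (IsLocalRing.maximalIdeal R)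
    (by rw [hrs, smul_eq_mul, Ideal.mul_top]))) _

/-- Localizing `A ⧸ p` at `p` gives the residue field of `A_p`. -/
theorem exists_hasProjectiveDimensionLE_localizedModule {A : Type u} [CommRing A]
    (p : Ideal A) [p.IsPrime] [IsRegularLocalRing (Localization.AtPrime p)] :
    ∃ n : ℕ, HasProjectiveDimensionLE
      ((ModuleCat.of A (A ⧸ p)).localizedModule p.primeCompl) n := by
  obtain ⟨n, hn⟩ := IsRegularLocalRing.exists_hasProjectiveDimensionLE (Localization.AtPrime p)
  let R := Localization.AtPrime p
  let q : Submodule R R := Submodule.localized' R p.primeCompl (Algebra.linearMap A R) p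
  have hq : q = IsLocalRing.maximalIdeal R := by
    rw [← Localization.AtPrime.map_eq_maximalIdeal]
    exact Ideal.localized'_eq_map _ _ _
  have : IsLocalizedModule p.primeCompl
      ((ModuleCat.of A (A ⧸ p)).localizedModuleMkLinearMap p.primeCompl) :=
    ModuleCat.localizedModule_isLocalizedModule _ _
  have e : (R ⧸ q) ≃ₗ[R] (ModuleCat.of A (A ⧸ p)).localizedModule p.primeCompl :=
    LinearEquiv.extendScalarsOfIsLocalization p.primeCompl R
      (IsLocalizedModule.linearEquiv p.primeCompl
        (Submodule.toLocalizedQuotient' R p.primeCompl (Algebra.linearMap A R) p)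
        ((ModuleCat.of A (A ⧸ p)).localizedModuleMkLinearMap p.primeCompl))
  exact ⟨n, hasProjectiveDimensionLT_of_iso
    (((Submodule.quotEquivOfEq _ _ hq.symm).trans e).toModuleIso) _⟩

/-! ### Noetherian modules, dévissage and induction on primes. -/

theorem isThickSubcategory_noetherianModules (A : Type u) [CommRing A] :
    IsThickSubcategory (noetherianModules A) where
  containsZero := ⟨ModuleCat.of A PUnit, ModuleCat.isZero_of_subsingleton _,
    (inferInstance : IsNoetherian A PUnit.{u + 1})⟩
  biprod X Y (_ : IsNoetherian A X) (_ : IsNoetherian A Y) :=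
    isNoetherian_of_linearEquiv (ModuleCat.biprodIsoProd X Y).symm.toLinearEquiv
  isStableUnderRetracts := ⟨fun {_ Y} r (_ : IsNoetherian A Y) =>
    isNoetherian_of_surjective (f := r.r.hom) (LinearMap.range_eq_top.mpr
      ((ModuleCat.epi_iff_surjective r.r).mp inferInstance))⟩
  left S hS (_ : IsNoetherian A S.X₂) _ :=
    isNoetherian_of_injective S.f.hom ((ModuleCat.mono_iff_injective _).mp hS.mono_f)
  middle S hS (_ : IsNoetherian A S.X₁) (_ : IsNoetherian A S.X₃) :=
    isNoetherian_of_range_eq_ker S.f.hom S.g.hom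
      (LinearMap.exact_iff.mp
        ((ShortComplex.ShortExact.moduleCat_exact_iff_function_exact _).mp hS.exact)).symm
  right S hS _ (_ : IsNoetherian A S.X₂) :=
    isNoetherian_of_surjective (f := S.g.hom) (LinearMap.range_eq_top.mpr
      ((ModuleCat.epi_iff_surjective _).mp hS.epi_g))

section

variable {A : Type u} [CommRing A] [IsNoetherianRing A] {P : ObjectProperty (ModuleCat.{u} A)}

/-- Dévissage: a finite module killed by `I` belongs to a thick subcategory that contains `A ⧸ q`
for all primes `q ⊇ I`. -/
theorem IsThickSubcategory.of_le_annihilator (hP : IsThickSubcategory P) (I : Ideal A)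
    (h : ∀ q : PrimeSpectrum A, I ≤ q.asIdeal → P (ModuleCat.of A (A ⧸ q.asIdeal)))
    (M : Type u) [AddCommGroup M] [Module A M] [Module.Finite A M]
    (hM : I ≤ Module.annihilator A M) : P (ModuleCat.of A M) := by
  induction ‹Module.Finite A M› using
    IsNoetherianRing.induction_on_isQuotientEquivQuotientPrime A with
  | subsingleton N => exact hP.of_subsingleton
  | quotient N q e =>
    refine hP.of_linearEquiv e.symm (h q ?_)
    rwa [e.annihilator_eq, Ideal.annihilator_quotient] at hM
  | exact N₁ N₂ N₃ f g hf hg hfg h₁ h₃ =>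
    exact hP.middle_of_exact hf hg hfg (h₁ (hM.trans (f.annihilator_le_of_injective hf)))
      (h₃ (hM.trans (g.annihilator_le_of_surjective hg)))

/-- As `A ⧸ p` is a domain and `s ∉ p`, `s` is regular on it. The quotient by `s` is killed by `p +
(s)`, and every prime containing this ideal is strictly larger than `p`. -/
theorem IsThickSubcategory.quotient_of_isRegularLocalRing (hP : IsThickSubcategory P)
    (hA : P (ModuleCat.of A A)) (p : Ideal A) [p.IsPrime]
    [IsRegularLocalRing (Localization.AtPrime p)]
    (h : ∀ q : PrimeSpectrum A, p < q.asIdeal → P (ModuleCat.of A (A ⧸ q.asIdeal))) :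
    P (ModuleCat.of A (A ⧸ p)) := by
  obtain ⟨n, hn⟩ := exists_hasProjectiveDimensionLE_localizedModule p
  obtain ⟨s, hs, hsn⟩ := exists_sMulFactorsOnSyzygy p.primeCompl n (ModuleCat.of A (A ⧸ p))
  have hsp : Ideal.Quotient.mk p s ≠ 0 := fun h => hs (Ideal.Quotient.eq_zero_iff_mem.mp h)
  refine hP.of_sMulFactorsOnSyzygy hA hsn fun k π hπ =>
    hP.smulPullback_of_quotSMulTop hπ ?_ (hP.pi_fin hA k) ?_
  · intro x y hxy
    simp only [Algebra.smul_def] at hxy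
    exact mul_left_cancel₀ hsp hxy
  · refine hP.of_le_annihilator (p ⊔ Ideal.span {s}) (fun q hq => h q ?_) _ ?_
    · refine lt_of_le_of_ne (le_sup_left.trans hq) fun hpq => hs ?_
      rw [hpq]
      exact hq (Ideal.mem_sup_right (Ideal.mem_span_singleton_self s))
    · refine sup_le ?_ ?_
      · refine Ideal.annihilator_quotient.ge.trans (LinearMap.annihilator_le_of_surjective
          (Submodule.mkQ _) (Submodule.mkQ_surjective _))
      · rw [Ideal.span_singleton_le_iff_mem]
        exact QuotSMulTop.mem_annihilator _ s

theorem IsThickSubcategory.quotient_of_schoutensGenerators_le (hP : IsThickSubcategory P)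
    (hQ : schoutensGenerators A ≤ P) (p : PrimeSpectrum A) :
    P (ModuleCat.of A (A ⧸ p.asIdeal)) := by
  -- The ascending chain condition on ideals allows the induction to run from larger primes to
  -- smaller ones.
  have : WellFoundedGT (PrimeSpectrum A) :=
    ⟨InvImage.wf PrimeSpectrum.asIdeal (wellFounded_gt (α := Ideal A))⟩
  induction p using WellFoundedGT.induction with
  | ind p ih =>
    by_cases hp : p ∈ singularLocus A
    · exact hQ _ (Or.inr ⟨p, hp, rfl⟩)
    · have : IsRegularLocalRing (Localization.AtPrime p.asIdeal) := not_not.mp hp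
      exact hP.quotient_of_isRegularLocalRing (hQ _ (Or.inl rfl)) p.asIdeal fun q hq => ih q hq

end

/-- The smallest thick subcategory of the category of `A`-modules containing `A` and all `A/p` with
`p` in the singular locus of `A` is the category of noetherian `A`-modules. -/
theorem mainTheorem3 (A : Type u) [CommRing A] [IsNoetherianRing A] :
    thickClosure (schoutensGenerators A) = noetherianModules A := by
  refine le_antisymm (fun M hM => hM _ (isThickSubcategory_noetherianModules A) ?_)
    fun M (_ : IsNoetherian A M) P hP hQ => hP.of_le_annihilator ⊥
      (fun q _ => hP.quotient_of_schoutensGenerators_le hQ q) M bot_le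
  rintro _ (rfl | ⟨p, -, rfl⟩)
  · exact (inferInstance : IsNoetherian A A)
  · exact (inferInstance : IsNoetherian A (A ⧸ p.asIdeal))
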